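/- A space $Z$ is *orderable* if its topology is the order topology of some linear order on $Z$, and *suborderable* if it is homeomorphic to a subspace of an orderable space. For a set $E$, let $\mathcal F_2(E)=\{F\subset E: 1\le |F|\le 2\}$. A *weak selection* on $E$ is a map $\sigma:\mathcal F_2(E)\to E$ with $\sigma(F)\in F$ for all $F$; write $x\prec_\sigma y$ if $x\ne y$ and $\sigma(\{x,y\})=x$. A weak selection $\sigma$ on a topological space $E$ is *separately continuous* if for every $x\in E$ the sets $\{z: z\prec_\sigma x\}$ and $\{z: x\prec_\sigma z\}$ are open in $E$ (equivalently, the topology generated by all these sets is contained in the topology of $E$). For a non-isolated point $p$ of a space $X$ let $a(p,X)$ be the least cardinal $\kappa$ such that $p\in\overline A$ for some $A\subset X\setminus\{p\}$ with $|A|\le\kappa$, and for non-discrete $X$ let $a(X)=\min\{a(p,X): p \text{ a non-isolated point of } X\}$. For $p\in X$ let $\psi(p,X)$ be the least cardinal $\kappa$ such that $\{p\}$ is the intersection of $\kappa$ many open subsets of $X$, and let $\psi(X)=\sup\{\psi(p,X):p\in X\}$. **Corollary.** Let $X$ be a non-discrete Hausdorff space that is the image of a suborderable space under a closed continuous map.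 If $X\times X$ (with the product topology) admits a separately continuous weak selection, then $X$ is hereditarily paracompact (every subspace of $X$ is paracompact), $X$ is totally disconnected (any two distinct points of $X$ are separated by a clopen set), and $\psi(X)\le a(X)$. -/

import Mathlib

open Cardinal
open scoped Topology

universe u v w

/-- A space is orderable if its topology is the order topology of some linear order. -/
def OrderableSpace (L : Type w) [TopologicalSpace L] : Prop :=
  ∃ _ : LinearOrder L, OrderTopology L

/-- A space is suborderable if it is (homeomorphic to) a subspace of an orderable space. -/
def SuborderableSpace (Z : Type v) [TopologicalSpace Z] : Prop :=
  ∃ (L : Type w) (_ : TopologicalSpace L),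
    OrderableSpace L ∧ ∃ e : Z → L, Topology.IsEmbedding e

/-- The set of all nonempty subsets of `X` with at most two points. -/
def FTwo (X : Type u) : Type u :=
  {F : Set X // 1 ≤ F.encard ∧ F.encard ≤ 2}

/-- The unordered pair `{x, y}` as an element of `FTwo X` (a singleton if `x = y`). -/
def FTwo.pair {X : Type u} (x y : X) : FTwo X :=
  ⟨{x, y}, Set.one_le_encard_iff_nonempty.mpr ⟨x, Set.mem_insert x {y}⟩,
    (Set.encard_insert_le {y} x).trans (by rw [Set.encard_singleton]; norm_num)⟩

/-- A weak selection on `X` picks a point of each nonempty subset with at most two points. -/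
def IsWeakSelection {X : Type u} (σ : FTwo X → X) : Prop :=
  ∀ F : FTwo X, σ F ∈ F.1

/-- The relation `x ⪯ y` determined by a weak selection: `σ {x, y} = x`. -/
def selLE {X : Type u} (σ : FTwo X → X) (x y : X) : Prop :=
  σ (FTwo.pair x y) = x

/-- The strict relation `x ≺ y`: `x ⪯ y` and `x ≠ y`. -/
def selLT {X : Type u} (σ : FTwo X → X) (x y : X) : Prop :=
  selLE σ x y ∧ x ≠ y

/-- The selection topology, generated by the open half-intervals of the selection relation. -/
@[reducible]
def selectionTopology {X : Type u} (σ : FTwo X → X) : TopologicalSpace X :=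
  TopologicalSpace.generateFrom
    {s | ∃ x : X, s = {z | selLT σ z x} ∨ s = {z | selLT σ x z}}

/-- A weak selection on a space is separately continuous if every set that is open in the
selection topology is open in the space. -/
def IsSeparatelyContinuousSelection {X : Type u} [TopologicalSpace X] (σ : FTwo X → X) : Prop :=
  ∀ U : Set X, IsOpen[selectionTopology σ] U → IsOpen U

/-- The space `X` admits a separately continuous weak selection. -/
def AdmitsSepContWeakSelection (X : Type u) [TopologicalSpace X] : Prop :=
  ∃ σ : FTwo X → X, IsWeakSelection σ ∧ IsSeparatelyContinuousSelection σ

/-- Every subspace is paracompact (used for Hausdorff spaces only). -/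
def HereditarilyParacompact (X : Type u) [TopologicalSpace X] : Prop :=
  ∀ A : Set X, ParacompactSpace A

/-- The approaching number `a(p, X)` of a non-isolated point `p`: the least `κ` such that `p` is in
the closure of some `A ⊆ X \ {p}` of cardinality at most `κ`. -/
noncomputable def approachingNumberAt (X : Type u) [TopologicalSpace X] (p : X) : Cardinal.{u} :=
  sInf {κ | ∃ A : Set X, A ⊆ {p}ᶜ ∧ p ∈ closure A ∧ #A ≤ κ}

/-- The approaching number `a(X)` of a non-discrete space: the minimum of `a(p, X)` over all
non-isolated points `p`. -/
noncomputable def approachingNumber (X : Type u) [TopologicalSpace X] : Cardinal.{u} :=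
  sInf {κ | ∃ p : X, ¬ IsOpen ({p} : Set X) ∧ κ = approachingNumberAt X p}

/-- The pseudo-character `ψ(p, X)`: the least `κ` such that `{p}` is the intersection of a family of
`κ` open sets. -/
noncomputable def pseudoCharacterAt (X : Type u) [TopologicalSpace X] (p : X) : Cardinal.{u} :=
  sInf {κ | ∃ 𝒰 : Set (Set X), (∀ U ∈ 𝒰, IsOpen U) ∧ ⋂₀ 𝒰 = {p} ∧ #𝒰 = κ}

/-- The pseudo-character `ψ(X)`, the supremum of `ψ(p, X)` over all points (a supremum over a small
family of cardinals, hence a genuine one). -/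
noncomputable def pseudoCharacter (X : Type u) [TopologicalSpace X] : Cardinal.{u} :=
  ⨆ p : X, pseudoCharacterAt X p

/-! Only the strict relation `R` of the selection matters: a tournament on `X × X` with open
half-intervals.

Let `p` be in the closure of a set `A` that omits `p`. For `x ∈ A` the points `(x, q)` and `(p, y)`
never coincide, so comparing them cuts the `y`-axis into two clopen sets. Letting `x` tend to `p`
shows that at most `#A + #A` such sets intersect in `{q}` (`IsOpenTournament.exists_clopen_family`).
This gives total separation and the bound on `ψ`.

Paracompactness goes through Michael's criterion: closure preserving closed refinements survive
closed maps, so it suffices to find them on the ordered domain. Moving along a regular cofinal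
sequence there, either the initial parts are closed on a club and cut the space into clopen slices,
or on a stationary set they have a limit outside. Such limits form a left continuous map into `X`,
which the tournament forces to be constant on a stationary set
(`exists_constant_of_isOpenTournament`); pressing down then puts a whole tail into one member of the
cover. -/

/-! ### Stationary sets and pressing down in regular well-orders -/

section Stationary

variable {W : Type*} [LinearOrder W]

/-- Every map sends every proper initial segment to a strictly bounded set. For a well-order
without maximum this is regularity of its order type. -/
def RegularSegments (W : Type*) [LinearOrder W] : Prop :=
  ∀ (a : W) (g : W → W), ∃ b, ∀ x < a, g x < b

/-- `T` meets the set of non-minimal closure points of every self-map. For regular uncountable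
order types these are the stationary sets. -/
def MeetsClosurePoints (T : Set W) : Prop :=
  ∀ g : W → W, ∃ a ∈ T, (∃ b, b < a) ∧ ∀ b < a, g b < a

theorem RegularSegments.exists_bound_le [NoMaxOrder W] (hW : RegularSegments W) (a : W)
    (g : W → W) : ∃ b, ∀ x ≤ a, g x < b := by
  obtain ⟨a', ha'⟩ := exists_gt a
  obtain ⟨b, hb⟩ := hW a' g
  exact ⟨b, fun x hx => hb x (hx.trans_lt ha')⟩

theorem MeetsClosurePoints.mono {S T : Set W} (hS : MeetsClosurePoints S) (h : S ⊆ T) :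
    MeetsClosurePoints T := fun g => by
  obtain ⟨a, ha, h'⟩ := hS g
  exact ⟨a, h ha, h'⟩

theorem MeetsClosurePoints.inter_closurePoints {T : Set W} (hT : MeetsClosurePoints T)
    (g : W → W) : MeetsClosurePoints {a ∈ T | (∃ b, b < a) ∧ ∀ b < a, g b < a} := fun g' => by
  obtain ⟨a, ha, hb, h⟩ := hT fun b => max (g b) (g' b)
  exact ⟨a, ⟨ha, hb, fun b hb => (le_max_left _ _).trans_lt (h b hb)⟩, hb,
    fun b hb => (le_max_right _ _).trans_lt (h b hb)⟩

theorem MeetsClosurePoints.inter_Ioi {T : Set W} (hT : MeetsClosurePoints T) (c : W) :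
    MeetsClosurePoints {a ∈ T | c < a} := by
  refine (hT.inter_closurePoints fun _ => c).mono ?_
  rintro a ⟨ha, ⟨b, hb⟩, h⟩
  exact ⟨ha, h b hb⟩

theorem MeetsClosurePoints.exists_gt {T : Set W} (hT : MeetsClosurePoints T) (c : W) :
    ∃ a ∈ T, c < a := by
  obtain ⟨a, ha, -⟩ := hT.inter_Ioi c fun b => b
  exact ⟨a, ha⟩

theorem MeetsClosurePoints.or_of_union {S T : Set W} (h : MeetsClosurePoints (S ∪ T)) :
    MeetsClosurePoints S ∨ MeetsClosurePoints T := by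
  by_contra! hn
  obtain ⟨hS, hT⟩ := hn
  simp only [MeetsClosurePoints, not_forall] at hS hT
  obtain ⟨g, hg⟩ := hS
  obtain ⟨g', hg'⟩ := hT
  obtain ⟨a, ha, hb, h⟩ := h fun b => max (g b) (g' b)
  rcases ha with ha | ha
  · exact hg ⟨a, ha, hb, fun b hb => (le_max_left _ _).trans_lt (h b hb)⟩
  · exact hg' ⟨a, ha, hb, fun b hb => (le_max_right _ _).trans_lt (h b hb)⟩

/-- The pressing down lemma. -/
theorem MeetsClosurePoints.pressing_down [NoMaxOrder W] (hW : RegularSegments W) {T : Set W}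
    (hT : MeetsClosurePoints T) {P : W → W → Prop} (hP : ∀ a ∈ T, (∃ b, b < a) → ∃ b < a, P a b) :
    ∃ b, MeetsClosurePoints {a ∈ T | b < a ∧ P a b} := by
  by_contra! hn
  simp only [MeetsClosurePoints, not_forall] at hn
  choose g hg using hn
  -- Diagonal intersection: `B d b` bounds `g b` on `x ≤ d`, and `G d` bounds `B d b` over `b ≤ d`,
  -- so a point closed under `G` is closed under `g b` for every `b` below it.
  choose B hB using fun d c => hW.exists_bound_le d (g c)
  choose G hG using fun d => hW.exists_bound_le d (B d)
  obtain ⟨a, ha, hb, h⟩ := hT G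
  obtain ⟨b, hba, hPb⟩ := hP a ha hb
  refine hg b ⟨a, ⟨ha, hba, hPb⟩, hb, fun c hc => ?_⟩
  have hd : max b c < a := max_lt hba hc
  exact ((hB (max b c) b c (le_max_right _ _)).trans (hG (max b c) b (le_max_left _ _))).trans
    (h _ hd)

end Stationary

/-! ### Left continuous maps against open tournaments -/

/-- A tournament on a space all of whose half-intervals are open. -/
structure IsOpenTournament {E : Type*} [TopologicalSpace E] (R : E → E → Prop) : Prop where
  total : ∀ {x y}, x ≠ y → R x y ∨ R y x
  asymm : ∀ {x y}, R x y → ¬ R y x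
  isOpen_right : ∀ x, IsOpen {y | R x y}
  isOpen_left : ∀ x, IsOpen {y | R y x}

section LeftContinuous

variable {W X : Type*} [LinearOrder W] [TopologicalSpace X]

/-- Continuity from the left at a point of a linear order. -/
def LeftContinuousAt (h : W → X) (a : W) : Prop :=
  ∀ U : Set X, IsOpen U → h a ∈ U → ∃ b < a, ∀ c, b < c → c ≤ a → h c ∈ U

/-- Of two open sets covering the space, one contains a tail of a left continuous map. -/
theorem exists_tail_of_isOpen [NoMaxOrder W] (hW : RegularSegments W) {T : Set W}
    (hT : MeetsClosurePoints T) {h : W → X} (hh : ∀ a ∈ T, LeftContinuousAt h a)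
    {U V : Set X} (hU : IsOpen U) (hV : IsOpen V) (hUV : ∀ x, x ∈ U ∨ x ∈ V) :
    ∃ b, (∀ c, b < c → h c ∈ U) ∨ (∀ c, b < c → h c ∈ V) := by
  have main : ∀ O : Set X, IsOpen O → MeetsClosurePoints {a ∈ T | h a ∈ O} →
      ∃ b, ∀ c, b < c → h c ∈ O := by
    intro O hO hTO
    -- The intervals `(b, a]` with `b` fixed and `a` in a large, hence unbounded, set exhaust the
    -- tail beyond `b`.
    obtain ⟨b, hb⟩ := hTO.pressing_down hW (P := fun a b => ∀ c, b < c → c ≤ a → h c ∈ O)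
      (fun a ha _ => hh a ha.1 O hO ha.2)
    refine ⟨b, fun c hc => ?_⟩
    obtain ⟨a, ha, hca⟩ := hb.exists_gt c
    exact ha.2.2 c hc hca.le
  have : MeetsClosurePoints ({a ∈ T | h a ∈ U} ∪ {a ∈ T | h a ∈ V}) := by
    refine hT.mono fun a ha => ?_
    rcases hUV (h a) with h1 | h1
    · exact Or.inl ⟨ha, h1⟩
    · exact Or.inr ⟨ha, h1⟩
  rcases this.or_of_union with h1 | h1
  · obtain ⟨b, hb⟩ := main U hU h1
    exact ⟨b, Or.inl hb⟩
  · obtain ⟨b, hb⟩ := main V hV h1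
    exact ⟨b, Or.inr hb⟩

/-- Unless it is constant on a large set, a left continuous map approaches one of its values by
values of an initial segment. -/
theorem exists_mem_closure_image_Iio [NoMaxOrder W] (hW : RegularSegments W) {T : Set W}
    (hT : MeetsClosurePoints T) {h : W → X} (hh : ∀ a ∈ T, LeftContinuousAt h a)
    (hn : ∀ x, ¬ MeetsClosurePoints {a ∈ T | h a = x}) :
    ∃ a, h a ∈ closure (h '' Set.Iio a \ {h a}) := by
  by_contra! hcl
  -- Otherwise left continuity, applied to the complement of that closure, makes `h` constant on
  -- some `(b, a]`, and pressing down fixes `b`.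
  obtain ⟨b, hb⟩ := hT.pressing_down hW (P := fun a b => ∀ c, b < c → c ≤ a → h c = h a) (by
    intro a ha _
    obtain ⟨b, hba, hb⟩ := hh a ha (closure (h '' Set.Iio a \ {h a}))ᶜ isClosed_closure.isOpen_compl
      (hcl a)
    refine ⟨b, hba, fun c hbc hca => ?_⟩
    by_contra hne
    refine hb c hbc hca (subset_closure ⟨⟨c, lt_of_le_of_ne hca ?_, rfl⟩, hne⟩)
    rintro rfl
    exact hne rfl)
  obtain ⟨c, hc⟩ := exists_gt b
  refine hn (h c) ((hb.inter_Ioi c).mono ?_)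
  rintro a ⟨⟨haT, -, ha⟩, hca⟩
  exact ⟨haT, (ha c hc hca.le).symm⟩

/-- The selection relation of `X × X` forces left continuous maps from a regular well-order
to be constant on a large set. -/
theorem exists_constant_of_isOpenTournament [NoMaxOrder W] (hW : RegularSegments W) {T : Set W}
    (hT : MeetsClosurePoints T) {h : W → X} (hh : ∀ a ∈ T, LeftContinuousAt h a)
    {R : X × X → X × X → Prop} (hR : IsOpenTournament R) :
    ∃ x, MeetsClosurePoints {a ∈ T | h a = x} := by
  by_contra! hn
  obtain ⟨a₀, ha₀⟩ := exists_mem_closure_image_Iio hW hT hh hn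
  set p := h a₀
  set A := h '' Set.Iio a₀ \ {p}
  have hmix : ∀ x : X, Continuous fun z : X => (x, z) := fun x => by fun_prop
  -- relations between `(x, h s)` and `(y, h t)` do not depend on large `t`
  have htail : ∀ (x y : X) (s : W), x ≠ y → ∃ b, (∀ c, b < c → R (x, h s) (y, h c)) ∨
      (∀ c, b < c → R (y, h c) (x, h s)) := by
    intro x y s hxy
    exact exists_tail_of_isOpen hW hT hh (U := {z | R (x, h s) (y, z)})
      (V := {z | R (y, z) (x, h s)})
      ((hR.isOpen_right _).preimage (hmix y)) ((hR.isOpen_left _).preimage (hmix y))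
      (fun z => hR.total fun e => hxy (congrArg Prod.fst e))
  have hbd : ∀ s : W, ∃ b, s < b ∧ ∀ x ∈ A, ∀ c d, b < c → b < d →
      (R (x, h s) (p, h c) → R (x, h s) (p, h d)) ∧
      (R (p, h c) (x, h s) → R (p, h d) (x, h s)) ∧
      (R (p, h s) (x, h c) → R (p, h s) (x, h d)) ∧
      (R (x, h c) (p, h s) → R (x, h d) (p, h s)) := by
    intro s
    have key : ∀ γ : W, ∃ b, h γ ≠ p → ∀ c d, b < c → b < d →
        (R (h γ, h s) (p, h c) → R (h γ, h s) (p, h d)) ∧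
        (R (p, h c) (h γ, h s) → R (p, h d) (h γ, h s)) ∧
        (R (p, h s) (h γ, h c) → R (p, h s) (h γ, h d)) ∧
        (R (h γ, h c) (p, h s) → R (h γ, h d) (p, h s)) := by
      intro γ
      by_cases hγ : h γ = p
      · exact ⟨γ, fun h => (h hγ).elim⟩
      obtain ⟨b₁, h₁⟩ := htail (h γ) p s hγ
      obtain ⟨b₂, h₂⟩ := htail p (h γ) s (Ne.symm hγ)
      refine ⟨max b₁ b₂, fun _ c d hc hd => ?_⟩
      rw [max_lt_iff] at hc hd
      have a1 := @hR.asymm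
      rcases h₁ with h₁ | h₁ <;> rcases h₂ with h₂ | h₂ <;>
        exact ⟨fun _ => by grind, fun _ => by grind, fun _ => by grind, fun _ => by grind⟩
    choose b hb using key
    -- `A` is indexed by an initial segment, so regularity makes the bound uniform in `x`. The other
    -- term of the maximum only ensures `s < g s`, which `hmid` needs.
    obtain ⟨B, hB⟩ := hW a₀ b
    refine ⟨max B (Classical.choose (exists_gt s)),
      lt_max_of_lt_right (Classical.choose_spec (exists_gt s)), ?_⟩
    rintro x ⟨⟨γ, hγ, rfl⟩, hne⟩ c d hc hd
    have := (hB γ hγ).trans_le (le_max_left B (Classical.choose (exists_gt s)))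
    exact hb γ hne c d (this.trans hc) (this.trans hd)
  choose g hg hgA using hbd
  set S := {a ∈ T | (∃ b, b < a) ∧ ∀ b < a, g b < a}
  have hS : MeetsClosurePoints S := hT.inter_closurePoints g
  -- at closure points the comparison of `(x, h δ)` and `(p, h t)` does not depend on `t ≥ δ`
  have hmid : ∀ δ ∈ S, ∀ O : Set X, IsOpen O → ∀ O' : Set X, IsOpen O' → h δ ∈ O → h δ ∈ O' →
      ∃ s < δ, h s ∈ O ∧ h s ∈ O' := by
    intro δ hδ O hO O' hO' h1 h2
    obtain ⟨b, hb, hb'⟩ := hh δ hδ.1 (O ∩ O') (hO.inter hO') ⟨h1, h2⟩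
    exact ⟨g b, hδ.2.2 b hb, hb' _ (hg b) (hδ.2.2 b hb).le⟩
  -- If the comparisons at `t` and at `δ` disagreed, openness would carry both over to some `h s`
  -- with `s < δ`; but `δ` and `t` both exceed `g s`, where the comparison has already settled.
  have hdiag : ∀ δ ∈ S, ∀ t, δ < t → ∀ x ∈ A,
      (R (x, h δ) (p, h t) → R (x, h δ) (p, h δ)) ∧
      (R (p, h t) (x, h δ) → R (p, h δ) (x, h δ)) ∧
      (R (p, h δ) (x, h t) → R (p, h δ) (x, h δ)) ∧
      (R (x, h t) (p, h δ) → R (x, h δ) (p, h δ)) := by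
    intro δ hδ t hδt x hx
    have hne : x ≠ p := hx.2
    have e1 : ∀ z z' : X, (x, z) ≠ (p, z') := fun z z' e => hne (congrArg Prod.fst e)
    have lim : ∀ Q Q' : X × X, ∀ y y' : X, R (y, h δ) Q → R Q' (y', h δ) →
        ∃ s < δ, R (y, h s) Q ∧ R Q' (y', h s) := fun Q Q' y y' h1 h2 =>
      hmid δ hδ {z | R (y, z) Q} ((hR.isOpen_left Q).preimage (hmix y))
        {z | R Q' (y', z)} ((hR.isOpen_right Q').preimage (hmix y')) h1 h2
    refine ⟨fun h1 => ?_, fun h1 => ?_, fun h1 => ?_, fun h1 => ?_⟩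
    · refine (hR.total (e1 _ _)).resolve_right fun h2 => ?_
      obtain ⟨s, hs, h3, h4⟩ := lim _ _ _ _ h1 h2
      exact hR.asymm ((hgA s x hx t δ ((hδ.2.2 s hs).trans hδt) (hδ.2.2 s hs)).1 h3) h4
    · refine (hR.total (e1 _ _)).resolve_left fun h2 => ?_
      obtain ⟨s, hs, h3, h4⟩ := lim _ _ _ _ h2 h1
      exact hR.asymm ((hgA s x hx t δ ((hδ.2.2 s hs).trans hδt) (hδ.2.2 s hs)).2.1 h4) h3
    · refine (hR.total (e1 _ _)).resolve_left fun h2 => ?_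
      obtain ⟨s, hs, h3, h4⟩ := lim _ _ _ _ h1 h2
      exact hR.asymm ((hgA s x hx t δ ((hδ.2.2 s hs).trans hδt) (hδ.2.2 s hs)).2.2.1 h3) h4
    · refine (hR.total (e1 _ _)).resolve_right fun h2 => ?_
      obtain ⟨s, hs, h3, h4⟩ := lim _ _ _ _ h2 h1
      exact hR.asymm ((hgA s x hx t δ ((hδ.2.2 s hs).trans hδt) (hδ.2.2 s hs)).2.2.2 h4) h3
  obtain ⟨δ, hδ, -⟩ := hS id
  obtain ⟨t, ht, hne⟩ : ∃ t, δ < t ∧ h δ ≠ h t := by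
    by_contra! hc
    refine hn (h δ) ((hS.inter_Ioi δ).mono ?_)
    rintro a ⟨ha, hlt⟩
    exact ⟨ha.1, (hc a hlt).symm⟩
  have hcont : ∀ y : X, Continuous fun z : X => (z, y) := fun y => by fun_prop
  -- Replacing `p` by a nearby `x ∈ A` on either side preserves the comparison; `hdiag` then turns
  -- the two results into opposite comparisons of `(x, h δ)` and `(p, h δ)`.
  rcases hR.total (x := (p, h δ)) (y := (p, h t)) fun e => hne (congrArg Prod.snd e) with h1 | h1
  · obtain ⟨x, hx, hxA⟩ := mem_closure_iff.1 ha₀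
      ({x | R (x, h δ) (p, h t)} ∩ {x | R (p, h δ) (x, h t)})
      (((hR.isOpen_left (p, h t)).preimage (hcont (h δ))).inter
        ((hR.isOpen_right (p, h δ)).preimage (hcont (h t)))) ⟨h1, h1⟩
    have := hdiag δ hδ t ht x hxA
    exact hR.asymm (this.1 hx.1) (this.2.2.1 hx.2)
  · obtain ⟨x, hx, hxA⟩ := mem_closure_iff.1 ha₀
      ({x | R (p, h t) (x, h δ)} ∩ {x | R (x, h t) (p, h δ)})
      (((hR.isOpen_right (p, h t)).preimage (hcont (h δ))).inter
        ((hR.isOpen_left (p, h δ)).preimage (hcont (h t)))) ⟨h1, h1⟩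
    have := hdiag δ hδ t ht x hxA
    exact hR.asymm (this.2.1 hx.1) (this.2.2.2 hx.2)

end LeftContinuous

/-! ### Michael's criterion for paracompactness -/

section ClosurePreserving

variable {Y : Type*} [TopologicalSpace Y]

/-- Every subfamily has closed union. -/
def ClosurePreservingClosed {ι : Type*} (F : ι → Set Y) : Prop :=
  ∀ J : Set ι, IsClosed (⋃ i ∈ J, F i)

/-- Every open cover has a precise closure preserving closed refinement. -/
def HasClosurePreservingRefinements (Y : Type u) [TopologicalSpace Y] : Prop :=
  ∀ (ι : Type u) (U : ι → Set Y), (∀ i, IsOpen (U i)) → (⋃ i, U i) = Set.univ →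
    ∃ F : ι → Set Y, ClosurePreservingClosed F ∧ (∀ i, F i ⊆ U i) ∧ (⋃ i, F i) = Set.univ

theorem ClosurePreservingClosed.isClosed {ι : Type*} {F : ι → Set Y}
    (hF : ClosurePreservingClosed F) (i : ι) : IsClosed (F i) := by
  simpa using hF {i}

variable {Y : Type u} [TopologicalSpace Y]

/-- Refine the cover `{Aᶜ, Bᶜ}`: the complements of the two closed members separate `A` from `B`. -/
theorem HasClosurePreservingRefinements.normalSpace (hY : HasClosurePreservingRefinements Y) :
    NormalSpace Y := by
  refine ⟨fun A B hA hB hAB => ?_⟩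
  obtain ⟨F, hF, hFU, hcov⟩ := hY (ULift.{u} Bool) (fun b => bif b.down then Aᶜ else Bᶜ)
    (by rintro ⟨_ | _⟩ <;> simp [hA, hB]) (by
      refine Set.eq_univ_of_forall fun y => Set.mem_iUnion.2 ?_
      by_cases hy : y ∈ A
      · exact ⟨⟨false⟩, Set.disjoint_left.1 hAB hy⟩
      · exact ⟨⟨true⟩, hy⟩)
  refine ⟨(F ⟨true⟩)ᶜ, (F ⟨false⟩)ᶜ, (hF.isClosed _).isOpen_compl, (hF.isClosed _).isOpen_compl,
    fun y hy h => hFU _ h hy, fun y hy h => hFU _ h hy, ?_⟩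
  rw [Set.disjoint_left]
  intro y h1 h2
  obtain ⟨⟨_ | _⟩, hi⟩ := Set.mem_iUnion.1 (hcov ▸ Set.mem_univ y)
  · exact h2 hi
  · exact h1 hi

/-- A closure preserving closed refinement can be improved so that its members avoid all earlier
members of the given one. -/
theorem HasClosurePreservingRefinements.exists_next (hY : HasClosurePreservingRefinements Y)
    {ι : Type u} [LinearOrder ι] [WellFoundedLT ι] {U : ι → Set Y} (hU : ∀ i, IsOpen (U i))
    (hcov : (⋃ i, U i) = Set.univ) {F : ι → Set Y} (hF : ClosurePreservingClosed F)
    (hFU : ∀ i, F i ⊆ U i) :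
    ∃ G : ι → Set Y, ClosurePreservingClosed G ∧ (∀ i, G i ⊆ U i) ∧ (⋃ i, G i) = Set.univ ∧
      ∀ i, ∀ j < i, Disjoint (G i) (F j) := by
  obtain ⟨G, hG, hGU, hGc⟩ := hY ι (fun i => U i \ ⋃ j ∈ Set.Iio i, F j)
    (fun i => (hU i).sdiff (hF _)) (by
      -- The least `i` with `y ∈ U i` still works, because `F j ⊆ U j` for all earlier `j`.
      refine Set.eq_univ_of_forall fun y => Set.mem_iUnion.2 ?_
      have hne : {i | y ∈ U i}.Nonempty := Set.mem_iUnion.1 (hcov ▸ Set.mem_univ y)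
      refine ⟨WellFounded.min wellFounded_lt _ hne, WellFounded.min_mem _ _ hne, ?_⟩
      simp only [Set.mem_Iio, Set.mem_iUnion, not_exists]
      intro j hj hy
      exact WellFounded.not_lt_min wellFounded_lt {i | y ∈ U i} (hFU j hy) hj)
  refine ⟨G, hG, fun i => (hGU i).trans Set.sdiff_subset, hGc, fun i j hj => ?_⟩
  rw [Set.disjoint_left]
  intro y hy hy'
  exact (hGU i hy).2 (Set.mem_biUnion hj hy')

/-- Every open cover has an open refinement that is a countable union of disjoint families. -/
theorem HasClosurePreservingRefinements.exists_sigma_disjoint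
    (hY : HasClosurePreservingRefinements Y)
    {ι : Type u} {U : ι → Set Y} (hU : ∀ i, IsOpen (U i))
    (hcov : (⋃ i, U i) = Set.univ) :
    ∃ V : ℕ → ι → Set Y, (∀ n i, IsOpen (V n i)) ∧ (∀ n i, V n i ⊆ U i) ∧
      (∀ n i j, i ≠ j → Disjoint (V n i) (V n j)) ∧ ∀ y, ∃ n i, y ∈ V n i := by
  obtain ⟨_, _⟩ := exists_wellFoundedLT ι
  let D := {F : ι → Set Y // ClosurePreservingClosed F ∧ (∀ i, F i ⊆ U i) ∧
    (⋃ i, F i) = Set.univ}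
  obtain ⟨F₀, h₀⟩ := hY ι U hU hcov
  have step : ∀ F : D, ∃ G : D, ∀ i, ∀ j < i, Disjoint (G.1 i) (F.1 j) := by
    rintro ⟨F, hF⟩
    obtain ⟨G, h1, h2, h3, h4⟩ := hY.exists_next hU hcov hF.1 hF.2.1
    exact ⟨⟨G, h1, h2, h3⟩, h4⟩
  choose next hnext using step
  let F : ℕ → D := fun n => Nat.rec ⟨F₀, h₀⟩ (fun _ => next) n
  have hF : ∀ n i, ∀ j < i, Disjoint ((F (n + 1)).1 i) ((F n).1 j) := fun n => hnext (F n)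
  have hc : ∀ n y, ∃ i, y ∈ (F n).1 i := fun n y =>
    Set.mem_iUnion.1 (by rw [(F n).2.2.2]; exact Set.mem_univ y)
  have hsub : ∀ n i y, y ∉ ⋃ j ∈ {j | j ≠ i}, (F n).1 j → y ∈ (F n).1 i := by
    intro n i y hy
    obtain ⟨j, hj⟩ := hc n y
    by_cases hij : j = i
    · exact hij ▸ hj
    · exact (hy (Set.mem_biUnion hij hj)).elim
  -- The points that the `n`-th cover leaves to `i` alone: open by closure preservation, disjoint
  -- for different `i`.
  refine ⟨fun n i => (⋃ j ∈ {j | j ≠ i}, (F n).1 j)ᶜ, fun n i => ((F n).2.1 _).isOpen_compl,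
    fun n i y hy => (F n).2.2.1 i (hsub n i y hy), fun n i j hij => ?_, fun y => ?_⟩
  · rw [Set.disjoint_left]
    intro y hi hj
    exact hj (Set.mem_biUnion (show i ≠ j from hij) (hsub n i y hi))
  -- The least indices `s n` of members containing `y` cannot decrease forever. Where they stop,
  -- `hanti` leaves only the index `s n` at stage `n + 1`.
  · let s : ℕ → ι := fun n => WellFounded.min wellFounded_lt {i | y ∈ (F n).1 i} (hc n y)
    have hs : ∀ n, y ∈ (F n).1 (s n) := fun n => WellFounded.min_mem _ _ (hc n y)
    have hmin : ∀ n j, y ∈ (F n).1 j → s n ≤ j := fun n j hj =>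
      not_lt.1 (WellFounded.not_lt_min wellFounded_lt {i | y ∈ (F n).1 i} hj)
    have hanti : ∀ n, ∀ j, y ∈ (F (n + 1)).1 j → j ≤ s n := fun n j hj => by
      by_contra! hlt
      exact Set.disjoint_left.1 (hF n _ _ hlt) hj (hs n)
    obtain ⟨n, hn⟩ : ∃ n, s n ≤ s (n + 1) := by
      let m := WellFounded.min (wellFounded_lt (α := ι)) (Set.range s) ⟨_, 0, rfl⟩
      obtain ⟨n, hn⟩ : m ∈ Set.range s := WellFounded.min_mem _ _ _
      refine ⟨n, not_lt.1 fun h => ?_⟩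
      rw [hn] at h
      exact WellFounded.not_lt_min wellFounded_lt (Set.range s) ⟨n + 1, rfl⟩ h
    refine ⟨n + 1, s n, ?_⟩
    simp only [Set.mem_compl_iff, Set.mem_iUnion, not_exists]
    intro j hj hyj
    exact hj (le_antisymm (hanti n j hyj) (hn.trans (hmin (n + 1) j hyj)))

/-- Michael's theorem: closure preserving closed refinements imply paracompactness. -/
theorem HasClosurePreservingRefinements.paracompactSpace
    (hY : HasClosurePreservingRefinements Y) : ParacompactSpace Y := by
  have := hY.normalSpace
  refine ⟨fun ι U hU hcov => ?_⟩
  obtain ⟨V, hVo, hVU, hVd, hVc⟩ := hY.exists_sigma_disjoint hU hcov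
  let O : ℕ → Set Y := fun n => ⋃ i, V n i
  have hO : ∀ n, IsOpen (O n) := fun n => isOpen_iUnion (hVo n)
  obtain ⟨G, hG, hGO, hGc⟩ := hY (ULift.{u} ℕ) (fun n => O n.down) (fun n => hO _) (by
    refine Set.eq_univ_of_forall fun y => Set.mem_iUnion.2 ?_
    obtain ⟨n, i, h⟩ := hVc y
    exact ⟨⟨n⟩, Set.mem_iUnion.2 ⟨i, h⟩⟩)
  choose H hHo hGH hHO using fun n : ℕ =>
    normal_exists_closure_subset (hG.isClosed ⟨n⟩) (hO n) (hGO ⟨n⟩)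
  choose K hKo hHK hKO using fun n : ℕ =>
    normal_exists_closure_subset (isClosed_closure (s := H n)) (hO n) (hHO n)
  -- Cutting with `K n` makes layer `n` locally finite off `O n` too; removing earlier `closure (H
  -- m)` keeps layers beyond `n` away from `H n`.
  let P : ℕ × ι → Set Y := fun q => (V q.1 q.2 ∩ K q.1) \ ⋃ m ∈ Finset.range q.1, closure (H m)
  have hlayer : ∀ n y, ∃ N ∈ 𝓝 y, ∃ i₀ : Option ι, ∀ i, (P (n, i) ∩ N).Nonempty → some i = i₀ := by
    intro n y
    by_cases hy : y ∈ O n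
    · obtain ⟨i, hi⟩ := Set.mem_iUnion.1 hy
      refine ⟨V n i, (hVo n i).mem_nhds hi, some i, fun j ⟨z, hz, hz'⟩ => ?_⟩
      by_contra hij
      exact Set.disjoint_left.1 (hVd n j i fun e => hij (e ▸ rfl)) hz.1.1 hz'
    · refine ⟨(closure (K n))ᶜ, isClosed_closure.isOpen_compl.mem_nhds fun h => hy (hKO n h), none,
        fun j ⟨z, hz, hz'⟩ => ?_⟩
      exact (hz' (subset_closure hz.1.2)).elim
  refine ⟨ULift.{u} (ℕ × ι), fun q => P q.down, fun q => ?_, ?_, ?_, fun q => ⟨q.down.2, ?_⟩⟩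
  · refine ((hVo _ _).inter (hKo _)).sdiff ?_
    exact Set.Finite.isClosed_biUnion (Finset.finite_toSet _) fun _ _ => isClosed_closure
  · refine Set.eq_univ_of_forall fun y => Set.mem_iUnion.2 ?_
    have hex : ∃ n, y ∈ closure (H n) := by
      obtain ⟨n, hn⟩ := Set.mem_iUnion.1 (hGc ▸ Set.mem_univ y)
      exact ⟨n.down, subset_closure (hGH _ hn)⟩
    classical
    have h1 := Nat.find_spec hex
    obtain ⟨i, hi⟩ := Set.mem_iUnion.1 (hHO _ h1)
    refine ⟨⟨(Nat.find hex, i)⟩, ⟨hi, hHK _ h1⟩, ?_⟩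
    simp only [Finset.mem_range, Set.mem_iUnion, not_exists]
    exact fun m hm => Nat.find_min hex hm
  · intro y
    obtain ⟨⟨n⟩, hn⟩ := Set.mem_iUnion.1 (hGc ▸ Set.mem_univ y)
    choose N hN i₀ hi₀ using fun m => hlayer m y
    refine ⟨H n ∩ ⋂ m ∈ Finset.range (n + 1), N m, Filter.inter_mem ((hHo n).mem_nhds (hGH n hn))
      ((Filter.biInter_finset_mem _).2 fun m _ => hN m), ?_⟩
    refine Set.Finite.subset ((Finset.finite_toSet (Finset.range (n + 1))).biUnion
      (t := fun m => {q : ULift.{u} (ℕ × ι) | q.down.1 = m ∧ some q.down.2 = i₀ m})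
      fun m _ => ?_) ?_
    · refine Set.Subsingleton.finite ?_
      rintro ⟨⟨a, b⟩⟩ ⟨ha, hb⟩ ⟨⟨a', b'⟩⟩ ⟨ha', hb'⟩
      simp only at ha hb ha' hb'
      subst ha ha'
      rw [← hb', Option.some_inj] at hb
      rw [hb]
    · rintro ⟨⟨m, i⟩⟩ ⟨z, hz, hzH, hzN⟩
      have hmn : m ∈ Finset.range (n + 1) := by
        by_contra hm
        refine hz.2 (Set.mem_biUnion (x := n) ?_ (subset_closure hzH))
        simp only [Finset.mem_range] at hm ⊢
        simp only [Finset.coe_range, Set.mem_Iio]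
        omega
      refine Set.mem_biUnion (Finset.mem_coe.2 hmn) ⟨rfl, hi₀ m i ⟨z, hz, ?_⟩⟩
      exact Set.mem_iInter₂.1 hzN m hmn
  · exact fun y hy => hVU _ _ hy.1.1

end ClosurePreserving

/-! ### Regular cofinal sequences -/

/-- A linear order without maximum has a well-ordered cofinal subset of regular order type. -/
theorem exists_isCofinal_regularSegments (D : Type*) [LinearOrder D] [NoMaxOrder D] :
    ∃ W : Set D, IsCofinal W ∧ WellFoundedLT W ∧ NoMaxOrder W ∧ RegularSegments W := by
  obtain ⟨s, hs, hcard⟩ := Order.exists_cof_eq D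
  obtain ⟨r, hr, hord⟩ := Cardinal.exists_ord_eq s
  -- Here `r` well-orders `s` in the least possible type; on `W'` the given order agrees with `r`,
  -- so initial segments have fewer than `cof D` elements.
  let W' : Set s := {a | ∀ b, r b a → b < a}
  let W : Set D := Subtype.val '' W'
  have hW : IsCofinal W := hs.trans (isCofinal_setOfPred_imp_lt r)
  have hlift : ∀ a : W, ∃ b : s, b ∈ W' ∧ b.1 = a.1 := fun a => a.2
  choose φ hφ hφv using hlift
  have hφr : ∀ a b : W, a < b → r (φ a) (φ b) := by
    intro a b hab
    have hlt : φ a < φ b := by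
      rw [← Subtype.coe_lt_coe, hφv, hφv]
      exact hab
    rcases trichotomous_of r (φ a) (φ b) with h | h | h
    · exact h
    · exact (hlt.ne h).elim
    · exact (lt_asymm hlt (hφ a _ h)).elim
  have hgt : ∀ x : D, ∃ a : W, x < a := fun x => by
    obtain ⟨x', hx'⟩ := exists_gt x
    obtain ⟨a, ha, hxa⟩ := hW x'
    exact ⟨⟨a, ha⟩, hx'.trans_le hxa⟩
  refine ⟨W, hW, ⟨?_⟩, ⟨fun a => ?_⟩, fun a g => ?_⟩
  · exact Subrelation.wf (fun {a b} h => hφr a b h) (InvImage.wf φ hr.wf)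
  · obtain ⟨b, hb⟩ := hgt a
    exact ⟨b, hb⟩
  · have hsmall : #((fun x : W => (g x : D)) '' Set.Iio a) < Order.cof D := by
      refine Cardinal.mk_image_le.trans_lt ?_
      have h1 : #(Set.Iio a) ≤ #{b : s // r b (φ a)} :=
        Cardinal.mk_le_of_injective (f := fun x => ⟨φ x.1, hφr _ _ x.2⟩) (by
          intro x x' h
          have := congrArg (fun t => (t.1 : D)) h
          simp only [hφv] at this
          exact Subtype.ext (Subtype.ext this))
      refine h1.trans_lt ?_
      rw [← hcard]
      exact Cardinal.card_typein_lt (φ a) hord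
    have hnc : ¬ IsCofinal ((fun x : W => (g x : D)) '' Set.Iio a) := fun h =>
      hsmall.not_ge (Order.cof_le h)
    obtain ⟨x, hx⟩ := not_isCofinal_iff.1 hnc
    obtain ⟨b, hb⟩ := hgt x
    exact ⟨b, fun z hz => (hx _ ⟨z, hz, rfl⟩).trans hb⟩

/-! ### Gluing closure preserving covers -/

section SubordinateCover

variable {Z : Type*} [TopologicalSpace Z] {ι : Type*} {V : ι → Set Z}

/-- `D` is covered by a closure preserving closed family subordinate to `V`. -/
def ClosurePreservinglyCovered (V : ι → Set Z) (D : Set Z) : Prop :=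
  ∃ F : ι → Set Z, ClosurePreservingClosed F ∧ (∀ i, F i ⊆ V i) ∧ D ⊆ ⋃ i, F i

theorem ClosurePreservinglyCovered.mono {D E : Set Z} (hE : ClosurePreservinglyCovered V E)
    (h : D ⊆ E) : ClosurePreservinglyCovered V D := by
  obtain ⟨F, h1, h2, h3⟩ := hE
  exact ⟨F, h1, h2, h.trans h3⟩

theorem ClosurePreservinglyCovered.of_locallyFinite {J : Type*} {P : J → Set Z}
    (hP : LocallyFinite P) (hc : ∀ j, IsClosed (P j))
    (h : ∀ j, ClosurePreservinglyCovered V (P j)) : ClosurePreservinglyCovered V (⋃ j, P j) := by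
  choose F h1 h2 h3 using h
  refine ⟨fun i => ⋃ j, F j i ∩ P j, fun I => ?_, fun i => ?_, fun z hz => ?_⟩
  · have : (⋃ i ∈ I, ⋃ j, F j i ∩ P j) = ⋃ j, (⋃ i ∈ I, F j i) ∩ P j := by
      ext z
      simp only [Set.mem_iUnion, Set.mem_inter_iff]
      grind
    rw [this]
    exact (hP.subset fun j => Set.inter_subset_right).isClosed_iUnion
      fun j => (h1 j I).inter (hc j)
  · exact Set.iUnion_subset fun j => Set.inter_subset_left.trans (h2 j i)
  · obtain ⟨j, hj⟩ := Set.mem_iUnion.1 hz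
    obtain ⟨i, hi⟩ := Set.mem_iUnion.1 (h3 j hj)
    exact Set.mem_iUnion.2 ⟨i, Set.mem_iUnion.2 ⟨j, hi, hj⟩⟩

theorem ClosurePreservinglyCovered.union {D E : Set Z} (hD : ClosurePreservinglyCovered V D)
    (hE : ClosurePreservinglyCovered V E) : ClosurePreservinglyCovered V (D ∪ E) := by
  obtain ⟨F, h1, h2, h3⟩ := hD
  obtain ⟨G, h1', h2', h3'⟩ := hE
  refine ⟨fun i => F i ∪ G i, fun I => ?_, fun i => Set.union_subset (h2 i) (h2' i), ?_⟩
  · simp only [Set.iUnion_union_distrib]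
    exact (h1 I).union (h1' I)
  · rw [Set.iUnion_union_distrib]
    exact Set.union_subset_union h3 h3'

theorem ClosurePreservinglyCovered.of_isClosed {K : Set Z} (hK : IsClosed K) {i : ι}
    (h : K ⊆ V i) : ClosurePreservinglyCovered V K := by
  refine ⟨fun j => {z ∈ K | j = i}, fun I => ?_, ?_, fun z hz => Set.mem_iUnion.2 ⟨i, hz, rfl⟩⟩
  · by_cases hi : i ∈ I
    · convert hK using 1
      ext z
      simp only [Set.mem_iUnion, Set.mem_ofPred_eq]
      grind
    · convert isClosed_empty using 1
      ext z
      simp only [Set.mem_iUnion, Set.mem_ofPred_eq]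
      grind
  · rintro j z ⟨hz, rfl⟩
    exact h hz

end SubordinateCover

/-! ### Refinements on generalized ordered spaces -/

/-- A generalized ordered space: rays are open and there is a base of convex neighbourhoods. -/
structure IsGOSpace (Z : Type*) [LinearOrder Z] [TopologicalSpace Z] : Prop where
  isOpen_Iio : ∀ a : Z, IsOpen (Set.Iio a)
  isOpen_Ioi : ∀ a : Z, IsOpen (Set.Ioi a)
  exists_ordConnected : ∀ z : Z, ∀ U ∈ 𝓝 z, ∃ N ∈ 𝓝 z, N.OrdConnected ∧ N ⊆ U

section InitialPart

variable {Z W : Type*} [LinearOrder Z] [LinearOrder W]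

/-- The part of `C` lying strictly below some `y v`, `v < w`. -/
def initialPart (C : Set Z) (y : W → Z) (w : W) : Set Z :=
  {z ∈ C | ∃ v < w, z < y v}

theorem initialPart_mono (C : Set Z) (y : W → Z) : Monotone (initialPart C y) := by
  rintro a b hab z ⟨hz, v, hv, hzv⟩
  exact ⟨hz, v, hv.trans_le hab, hzv⟩

end InitialPart

section GOSpace

variable {Z : Type*} [LinearOrder Z] [TopologicalSpace Z]

theorem IsGOSpace.dual (hZ : IsGOSpace Z) : IsGOSpace Zᵒᵈ :=
  ⟨hZ.isOpen_Ioi, hZ.isOpen_Iio, fun z U hU => by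
    obtain ⟨N, h1, h2, h3⟩ := hZ.exists_ordConnected z U hU
    exact ⟨N, h1, h2.dual, h3⟩⟩

theorem IsGOSpace.isClosed_Iic (hZ : IsGOSpace Z) (a : Z) : IsClosed (Set.Iic a) := by
  rw [← isOpen_compl_iff, Set.compl_Iic]
  exact hZ.isOpen_Ioi a

theorem IsGOSpace.isClosed_Ici (hZ : IsGOSpace Z) (a : Z) : IsClosed (Set.Ici a) := by
  rw [← isOpen_compl_iff, Set.compl_Ici]
  exact hZ.isOpen_Iio a

theorem IsGOSpace.isClosed_Icc (hZ : IsGOSpace Z) (a b : Z) : IsClosed (Set.Icc a b) :=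
  (hZ.isClosed_Ici a).inter (hZ.isClosed_Iic b)

variable {W : Type*} [LinearOrder W]

theorem IsGOSpace.isOpen_initialPart (hZ : IsGOSpace Z) {C : Set Z} (hC : IsOpen C) (y : W → Z)
    (w : W) : IsOpen (initialPart C y w) := by
  have : initialPart C y w = C ∩ ⋃ v ∈ Set.Iio w, Set.Iio (y v) := by
    ext z
    simp [initialPart]
  rw [this]
  exact hC.inter (isOpen_biUnion fun v _ => hZ.isOpen_Iio _)

variable {ι : Type*} {V : ι → Set Z} {C : Set Z} {y : W → Z} {c : Z}

/-- If the initial parts at all closure points of `g` are closed, local covers of a clopen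
set fit together to the right. -/
theorem IsGOSpace.covered_of_isClosed_initialPart [NoMaxOrder W] [WellFoundedLT W]
    (hZ : IsGOSpace Z)
    (hW : RegularSegments W) (hC : IsClopen C) (hy : StrictMono y)
    (hcof : ∀ z ∈ C, ∃ w, z < y w)
    (hgood : ∀ w, ClosurePreservinglyCovered V (Set.Icc c (y w))) (g : W → W)
    (hg : ∀ a, (∀ b < a, g b < a) → IsClosed (initialPart C y a)) :
    ClosurePreservinglyCovered V (C ∩ Set.Ici c) := by
  -- With countable cofinality, closure points of `g` need not be unbounded, but countably many
  -- slices suffice.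
  by_cases hseq : ∃ s : ℕ → W, ∀ w, ∃ n, w < s n
  · obtain ⟨s, hs⟩ := hseq
    let P : ℕ → Set Z := fun n =>
      (C ∩ Set.Icc c (y (s n))) ∩ ⋂ m ∈ Finset.range n, Set.Ici (y (s m))
    have hex : ∀ z ∈ C, ∃ n, z < y (s n) := fun z hz => by
      obtain ⟨w, hw⟩ := hcof z hz
      obtain ⟨n, hn⟩ := hs w
      exact ⟨n, hw.trans (hy hn)⟩
    refine (ClosurePreservinglyCovered.of_locallyFinite (P := P) (fun z => ?_) (fun n => ?_)
      fun n => (hgood (s n)).mono fun z hz => hz.1.2).mono ?_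
    · by_cases hz : z ∈ C
      · obtain ⟨n, hn⟩ := hex z hz
        refine ⟨Set.Iio (y (s n)), (hZ.isOpen_Iio _).mem_nhds hn, (Set.finite_le_nat n).subset ?_⟩
        rintro m ⟨x, hx, hxn⟩
        by_contra hm
        exact not_le.2 hxn (Set.mem_iInter₂.1 hx.2 n (Finset.mem_range.2 (not_le.1 hm)))
      · refine ⟨Cᶜ, hC.compl.isOpen.mem_nhds hz, Set.finite_empty.subset ?_⟩
        rintro m ⟨x, hx, hxC⟩
        exact hxC hx.1.1
    · exact (hC.isClosed.inter (hZ.isClosed_Icc _ _)).inter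
        (isClosed_biInter fun m _ => hZ.isClosed_Ici _)
    · rintro z ⟨hz, hcz⟩
      classical
      have h1 := Nat.find_spec (hex z hz)
      refine Set.mem_iUnion.2 ⟨Nat.find (hex z hz), ⟨hz, hcz, h1.le⟩, Set.mem_iInter₂.2 ?_⟩
      intro m hm
      exact not_lt.1 (Nat.find_min (hex z hz) (Finset.mem_range.1 hm))
  · push Not at hseq
    let E : Set W := {a | ∀ b < a, g b < a}
    have hEclosed : ∀ a ∈ E, IsClosed (initialPart C y a) := hg
    have hEunb : ∀ w, ∃ a ∈ E, w < a := by
      intro w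
      choose B hB using fun d => hW.exists_bound_le d g
      let s : ℕ → W := fun n => Nat.rec w (fun _ d => max (B d) (Classical.choose (exists_gt d))) n
      have hs : ∀ n, s n < s (n + 1) := fun n =>
        lt_max_of_lt_right (Classical.choose_spec (exists_gt (s n)))
      have hsB : ∀ n, B (s n) ≤ s (n + 1) := fun n => le_max_left _ _
      obtain ⟨b, hb⟩ := hseq s
      have hne : {a | ∀ n, s n ≤ a}.Nonempty := ⟨b, hb⟩
      let a := WellFounded.min wellFounded_lt {a | ∀ n, s n ≤ a} hne
      have ha : ∀ n, s n ≤ a := WellFounded.min_mem wellFounded_lt {a | ∀ n, s n ≤ a} hne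
      refine ⟨a, fun x hx => ?_, (hs 0).trans_le (ha 1)⟩
      have : ¬ ∀ n, s n ≤ x := fun h =>
        WellFounded.not_lt_min wellFounded_lt {a | ∀ n, s n ≤ a} h hx
      push Not at this
      obtain ⟨n, hn⟩ := this
      exact ((hB (s n) x hn.le).trans_le (hsB n)).trans_le (ha (n + 1))
    let P : E → Set Z := fun a =>
      (initialPart C y a ∩ Set.Ici c) \ ⋃ b ∈ {b ∈ E | b < a.1}, initialPart C y b
    have hex : ∀ z ∈ C, ∃ a : E, z ∈ initialPart C y a ∧ ∀ b ∈ E, b < a → z ∉ initialPart C y b := by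
      intro z hz
      obtain ⟨w, hw⟩ := hcof z hz
      obtain ⟨a, ha, hwa⟩ := hEunb w
      have hne : {a | a ∈ E ∧ z ∈ initialPart C y a}.Nonempty := ⟨a, ha, hz, w, hwa, hw⟩
      have hm := WellFounded.min_mem wellFounded_lt {a | a ∈ E ∧ z ∈ initialPart C y a} hne
      refine ⟨⟨_, hm.1⟩, hm.2, fun b hb hlt hzb => ?_⟩
      exact WellFounded.not_lt_min wellFounded_lt {a | a ∈ E ∧ z ∈ initialPart C y a} ⟨hb, hzb⟩ hlt
    refine (ClosurePreservinglyCovered.of_locallyFinite (P := P) (fun z => ?_) (fun a => ?_)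
      fun a => (hgood a).mono ?_).mono ?_
    · by_cases hz : z ∈ C
      · obtain ⟨a, hza, hamin⟩ := hex z hz
        have hne : {s | ∀ b ∈ E, b < a → b ≤ s}.Nonempty := ⟨a, fun b _ h => h.le⟩
        -- `s` is the supremum of the elements of `E` below `a`; it lies in `E`, so the difference
        -- of the parts at `a` and `s` is an open neighbourhood meeting only the slice of `a`.
        let s := WellFounded.min wellFounded_lt {s | ∀ b ∈ E, b < a.1 → b ≤ s} hne
        have hs : ∀ b ∈ E, b < a → b ≤ s :=
          WellFounded.min_mem wellFounded_lt {s | ∀ b ∈ E, b < a.1 → b ≤ s} hne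
        have hslt : ∀ x < s, ∃ b ∈ E, b < a ∧ x < b := by
          intro x hx
          by_contra! hcon
          exact WellFounded.not_lt_min wellFounded_lt {s | ∀ b ∈ E, b < a.1 → b ≤ s} hcon hx
        have hsE : s ∈ E := fun x hx => by
          obtain ⟨b, hb, hba, hxb⟩ := hslt x hx
          exact (hb x hxb).trans_le (hs b hb hba)
        have hzs : z ∉ initialPart C y s := by
          rintro ⟨-, v, hv, hzv⟩
          obtain ⟨b, hb, hba, hvb⟩ := hslt v hv
          exact hamin b hb hba ⟨hz, v, hvb, hzv⟩
        refine ⟨initialPart C y a \ initialPart C y s,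
          ((hZ.isOpen_initialPart hC.isOpen y a).sdiff (hEclosed s hsE)).mem_nhds ⟨hza, hzs⟩,
          (Set.finite_singleton a).subset ?_⟩
        rintro b ⟨x, hx, hxa, hxs⟩
        rcases lt_trichotomy b a with h | h | h
        · exact (hxs (initialPart_mono C y (hs b b.2 h) hx.1.1)).elim
        · exact h
        · exact (hx.2 (Set.mem_biUnion (show a.1 ∈ {d ∈ E | d < b.1} from ⟨a.2, h⟩) hxa)).elim
      · refine ⟨Cᶜ, hC.compl.isOpen.mem_nhds hz, Set.finite_empty.subset ?_⟩
        rintro m ⟨x, hx, hxC⟩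
        exact hxC hx.1.1.1
    · exact ((hEclosed a a.2).inter (hZ.isClosed_Ici c)).sdiff
        (isOpen_biUnion fun b _ => hZ.isOpen_initialPart hC.isOpen y b)
    · rintro z ⟨⟨⟨-, v, hv, hzv⟩, hcz⟩, -⟩
      exact ⟨hcz, (hzv.trans (hy hv)).le⟩
    · rintro z ⟨hz, hcz⟩
      obtain ⟨a, hza, hamin⟩ := hex z hz
      refine Set.mem_iUnion.2 ⟨a, ⟨hza, hcz⟩, ?_⟩
      simp only [Set.mem_iUnion, not_exists]
      rintro b ⟨hb, hba⟩
      exact hamin b hb hba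

variable {X : Type*} [TopologicalSpace X] {f : Z → X} {U : ι → Set X}

/-- If the initial parts fail to be closed on a large set, a tail of a clopen set lies in
a single member of the cover. -/
theorem IsGOSpace.covered_of_not_isClosed_initialPart [NoMaxOrder W]
    (hZ : IsGOSpace Z)
    (hW : RegularSegments W) (hC : IsClopen C) (hy : StrictMono y)
    (hyC : ∀ w, y w ∈ C) (hcof : ∀ z ∈ C, ∃ w, z < y w)
    (hf : Continuous f) (hU : ∀ i, IsOpen (U i)) (hcov : (⋃ i, U i) = Set.univ)
    {E : Type*} [TopologicalSpace E] {e : X → E} (he : Continuous e) (hei : Function.Injective e)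
    {R : E × E → E × E → Prop} (hR : IsOpenTournament R)
    (hgood : ∀ w, ClosurePreservinglyCovered (fun i => f ⁻¹' U i) (Set.Icc c (y w)))
    (hT : MeetsClosurePoints {w | ¬ IsClosed (initialPart C y w)}) :
    ClosurePreservinglyCovered (fun i => f ⁻¹' U i) (C ∩ Set.Ici c) := by
  set T := {w | ¬ IsClosed (initialPart C y w)}
  -- The default `y w` off `T` keeps `y v ≤ l w ≤ y w` for all `v < w`, since left continuity at
  -- points of `T` involves every index.
  have hlim : ∀ w, ∃ z ∈ C, (w ∈ T → z ∈ closure (initialPart C y w) ∧ z ∉ initialPart C y w) ∧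
      (w ∉ T → z = y w) := by
    intro w
    by_cases hw : w ∈ T
    · have : ¬ closure (initialPart C y w) ⊆ initialPart C y w := fun h =>
        hw (isClosed_of_closure_subset h)
      obtain ⟨z, hz, hz'⟩ := Set.not_subset.1 this
      exact ⟨z, closure_minimal (fun x hx => hx.1) hC.isClosed hz, fun _ => ⟨hz, hz'⟩,
        fun h => (h hw).elim⟩
    · exact ⟨y w, hyC w, fun h => (hw h).elim, fun _ => rfl⟩
  choose l hlC hlT hlT' using hlim
  have hge : ∀ v w, v < w → y v ≤ l w := by
    intro v w hvw
    by_cases hw : w ∈ T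
    · by_contra! hlt
      exact (hlT w hw).2 ⟨hlC w, v, hvw, hlt⟩
    · rw [hlT' w hw]
      exact (hy hvw).le
  have hle : ∀ w, l w ≤ y w := by
    intro w
    by_cases hw : w ∈ T
    · refine closure_minimal ?_ (hZ.isClosed_Iic (y w)) (hlT w hw).1
      rintro z ⟨-, v, hv, hzv⟩
      exact (hzv.trans (hy hv)).le
    · exact (hlT' w hw).le
  have hnear : ∀ w ∈ T, ∀ O : Set Z, IsOpen O → l w ∈ O → ∃ v < w, Set.Icc (y v) (l w) ⊆ O := by
    intro w hw O hO hlO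
    obtain ⟨N, hN, hNc, hNO⟩ := hZ.exists_ordConnected (l w) O (hO.mem_nhds hlO)
    obtain ⟨x, hxN, hx, v, hv, hxv⟩ := mem_closure_iff_nhds.1 (hlT w hw).1 N hN
    refine ⟨v, hv, fun z hz => hNO (hNc.out hxN (mem_of_mem_nhds hN) ⟨hxv.le.trans hz.1, hz.2⟩)⟩
  have hleft : ∀ w ∈ T, LeftContinuousAt (fun w => e (f (l w))) w := by
    intro w hw O hO hwO
    obtain ⟨v, hv, hsub⟩ := hnear w hw _ (hO.preimage (he.comp hf)) hwO
    refine ⟨v, hv, fun b hvb hbw => hsub ⟨hge v b hvb, ?_⟩⟩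
    rcases hbw.lt_or_eq with h | h
    · exact (hle b).trans (hge b w h)
    · rw [h]
  obtain ⟨x, hx⟩ := exists_constant_of_isOpenTournament hW hT hleft hR
  obtain ⟨w₀, hw₀, -⟩ := hx id
  obtain ⟨i, hi⟩ := Set.mem_iUnion.1 (hcov ▸ Set.mem_univ (f (l w₀)))
  obtain ⟨v, hv⟩ := hx.pressing_down hW (P := fun w v => Set.Icc (y v) (l w) ⊆ f ⁻¹' U i) (by
    rintro w ⟨hw, hwx⟩ -
    refine hnear w hw _ ((hU i).preimage hf) ?_
    have : f (l w) = f (l w₀) := hei (hwx.trans hw₀.2.symm)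
    rw [Set.mem_preimage, this]
    exact hi)
  have htail : C ∩ Set.Ici (y v) ⊆ f ⁻¹' U i := by
    rintro z ⟨hz, hvz⟩
    obtain ⟨w, hw⟩ := hcof z hz
    obtain ⟨a, ha, hwa⟩ := hv.exists_gt w
    exact ha.2.2 ⟨hvz, hw.le.trans (hge w a hwa)⟩
  refine ((hgood v).union (ClosurePreservinglyCovered.of_isClosed
    (V := fun i => f ⁻¹' U i) (hC.isClosed.inter (hZ.isClosed_Ici (y v))) htail)).mono ?_
  rintro z ⟨hz, hcz⟩
  rcases le_total z (y v) with h | h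
  · exact Or.inl ⟨hcz, h⟩
  · exact Or.inr ⟨hz, h⟩

/-- Without a maximum, a regular cofinal sequence in `C` reduces this to whether non-closed initial
parts occur at a large set of indices. -/
theorem IsGOSpace.covered_inter_Ici (hZ : IsGOSpace Z) (hC : IsClopen C)
    (hf : Continuous f) (hU : ∀ i, IsOpen (U i)) (hcov : (⋃ i, U i) = Set.univ)
    {E : Type*} [TopologicalSpace E] {e : X → E} (he : Continuous e) (hei : Function.Injective e)
    {R : E × E → E × E → Prop} (hR : IsOpenTournament R)
    (hgood : ∀ z ∈ C, ClosurePreservinglyCovered (fun i => f ⁻¹' U i) (Set.Icc c z)) :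
    ClosurePreservinglyCovered (fun i => f ⁻¹' U i) (C ∩ Set.Ici c) := by
  by_cases hmax : ∃ m ∈ C, ∀ z ∈ C, z ≤ m
  · obtain ⟨m, hm, hmax⟩ := hmax
    exact (hgood m hm).mono fun z hz => ⟨hz.2, hmax z hz.1⟩
  push Not at hmax
  have : NoMaxOrder C := ⟨fun a => by
    obtain ⟨b, hb, hab⟩ := hmax a a.2
    exact ⟨⟨b, hb⟩, hab⟩⟩
  obtain ⟨W, hWc, _, _, hW⟩ := exists_isCofinal_regularSegments C
  let y : W → Z := fun w => w.1.1
  have hy : StrictMono y := fun _ _ h => h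
  have hyC : ∀ w, y w ∈ C := fun w => w.1.2
  have hcof : ∀ z ∈ C, ∃ w, z < y w := by
    intro z hz
    obtain ⟨z', hz', hlt⟩ := hmax z hz
    obtain ⟨w, hw, hle⟩ := hWc ⟨z', hz'⟩
    exact ⟨⟨w, hw⟩, hlt.trans_le hle⟩
  by_cases hT : MeetsClosurePoints {w | ¬ IsClosed (initialPart C y w)}
  · exact hZ.covered_of_not_isClosed_initialPart hW hC hy hyC hcof hf hU hcov he hei hR
      (fun w => hgood _ (hyC w)) hT
  · simp only [MeetsClosurePoints, not_forall] at hT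
    obtain ⟨g, hg⟩ := hT
    refine hZ.covered_of_isClosed_initialPart hW hC hy hcof
      (fun w => hgood _ (hyC w)) g fun a ha => ?_
    by_contra hcl
    refine hg ⟨a, hcl, ?_, ha⟩
    -- A least index is no closure point for `MeetsClosurePoints`, but its initial part is empty.
    by_contra! hbot
    apply hcl
    convert isClosed_empty using 1
    refine Set.eq_empty_of_forall_notMem ?_
    rintro z ⟨-, v, hv, -⟩
    exact (hbot v).not_gt hv

/-- Open covers of `X` pull back to covers of a generalized ordered space with closure preserving
closed refinements. -/
theorem IsGOSpace.covered_univ (hZ : IsGOSpace Z)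
    (hf : Continuous f) (hU : ∀ i, IsOpen (U i)) (hcov : (⋃ i, U i) = Set.univ)
    {E : Type*} [TopologicalSpace E] {e : X → E} (he : Continuous e) (hei : Function.Injective e)
    {R : E × E → E × E → Prop} (hR : IsOpenTournament R) :
    ClosurePreservinglyCovered (fun i => f ⁻¹' U i) Set.univ := by
  set V := fun i => f ⁻¹' U i
  -- The classes will be clopen, so each can be covered separately, from one of its points to the
  -- right and, by duality, to the left.
  let r : Setoid Z :=
    { r := fun x y => ClosurePreservinglyCovered V (Set.uIcc x y)
      iseqv := by
        refine ⟨fun x => ?_, fun {x y} h => ?_, fun {x y z} h h' => ?_⟩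
        · obtain ⟨i, hi⟩ := Set.mem_iUnion.1 (hcov ▸ Set.mem_univ (f x))
          refine ClosurePreservinglyCovered.of_isClosed (i := i) ?_ ?_
          · exact hZ.isClosed_Icc _ _
          · rw [Set.uIcc_self, Set.singleton_subset_iff]
            exact hi
        · rwa [Set.uIcc_comm]
        · exact (h.union h').mono Set.uIcc_subset_uIcc_union_uIcc }
  let Cl : Quotient r → Set Z := fun q => {z | Quotient.mk r z = q}
  have hopen : ∀ q, IsOpen (Cl q) := by
    intro q
    rw [isOpen_iff_mem_nhds]
    rintro z rfl
    obtain ⟨i, hi⟩ := Set.mem_iUnion.1 (hcov ▸ Set.mem_univ (f z))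
    obtain ⟨N, hN, hNc, hNV⟩ := hZ.exists_ordConnected z (V i) (((hU i).preimage hf).mem_nhds hi)
    filter_upwards [hN] with x hx
    refine Quotient.sound (s := r) ?_
    exact ClosurePreservinglyCovered.of_isClosed (i := i) (hZ.isClosed_Icc _ _)
      ((hNc.uIcc_subset hx (mem_of_mem_nhds hN)).trans hNV)
  have hclosed : ∀ q, IsClosed (Cl q) := by
    intro q
    rw [← isOpen_compl_iff]
    have : (Cl q)ᶜ = ⋃ q' ∈ {q' | q' ≠ q}, Cl q' := by
      ext z
      simp [Cl]
    rw [this]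
    exact isOpen_biUnion fun q' _ => hopen q'
  refine (ClosurePreservinglyCovered.of_locallyFinite (P := Cl) (fun z => ?_) hclosed
    fun q => ?_).mono fun z _ => Set.mem_iUnion.2 ⟨Quotient.mk r z, rfl⟩
  · refine ⟨Cl (Quotient.mk r z), (hopen _).mem_nhds rfl,
      (Set.finite_singleton (Quotient.mk r z)).subset ?_⟩
    rintro q ⟨x, hx, hx'⟩
    exact hx.symm.trans hx'
  · induction q using Quotient.inductionOn with
    | h c =>
    have hrel : ∀ z ∈ Cl (Quotient.mk r c), ClosurePreservinglyCovered V (Set.uIcc z c) :=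
      fun z hz => Quotient.exact hz
    have hr := hZ.covered_inter_Ici (c := c) ⟨hclosed _, hopen _⟩ hf hU hcov he hei hR
      (fun z hz => (hrel z hz).mono (Set.uIcc_comm z c ▸ Set.Icc_subset_uIcc))
    have hl := hZ.dual.covered_inter_Ici (C := OrderDual.ofDual ⁻¹' Cl (Quotient.mk r c))
      (c := OrderDual.toDual c) (f := f ∘ OrderDual.ofDual) ⟨hclosed _, hopen _⟩
      hf hU hcov he hei hR
      (fun z hz => (hrel z hz).mono fun x hx => Set.Icc_subset_uIcc ⟨hx.2, hx.1⟩)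
    refine (hr.union hl).mono fun z hz => ?_
    rcases le_total c z with h | h
    · exact Or.inl ⟨hz, h⟩
    · exact Or.inr ⟨hz, h⟩

end GOSpace

/-! ### From selections and closed images to paracompactness -/

theorem FTwo.pair_comm {E : Type u} (x y : E) : FTwo.pair x y = FTwo.pair y x :=
  Subtype.ext (Set.pair_comm x y)

theorem AdmitsSepContWeakSelection.exists_isOpenTournament {E : Type u} [TopologicalSpace E]
    (h : AdmitsSepContWeakSelection E) : ∃ R : E → E → Prop, IsOpenTournament R := by
  obtain ⟨σ, hσ, hc⟩ := h
  refine ⟨selLT σ, fun {x y} hxy => ?_, fun {x y} h h' => ?_, fun x => ?_, fun x => ?_⟩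
  · rcases hσ (FTwo.pair x y) with h | h
    · exact Or.inl ⟨h, hxy⟩
    · exact Or.inr ⟨by rw [selLE, FTwo.pair_comm]; exact h, hxy.symm⟩
  · have h1 : σ (FTwo.pair x y) = x := h.1
    have h2 : σ (FTwo.pair y x) = y := h'.1
    rw [FTwo.pair_comm, h1] at h2
    exact h.2 h2
  · exact hc _ (TopologicalSpace.isOpen_generateFrom_of_mem ⟨x, Or.inr rfl⟩)
  · exact hc _ (TopologicalSpace.isOpen_generateFrom_of_mem ⟨x, Or.inl rfl⟩)

/-- A subspace of an ordered space is a generalized ordered space. -/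
theorem SuborderableSpace.exists_isGOSpace {Z : Type v} [TopologicalSpace Z]
    (hZ : SuborderableSpace.{v, w} Z) : ∃ _ : LinearOrder Z, IsGOSpace Z := by
  obtain ⟨L, _, ⟨_, _⟩, e, he⟩ := hZ
  let _ : LinearOrder Z := LinearOrder.lift' e he.injective
  have hmono : Monotone e := fun a b h => h
  refine ⟨inferInstance, fun a => isOpen_Iio.preimage he.continuous,
    fun a => isOpen_Ioi.preimage he.continuous, fun z U hU => ?_⟩
  rw [he.nhds_eq_comap, Filter.mem_comap] at hU
  obtain ⟨O, hO, hOU⟩ := hU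
  have hN : Set.ordConnectedComponent O (e z) ∈ 𝓝 (e z) := Set.ordConnectedComponent_mem_nhds.2 hO
  exact ⟨e ⁻¹' Set.ordConnectedComponent O (e z), he.continuous.continuousAt.preimage_mem_nhds hN,
    Set.OrdConnected.preimage_mono inferInstance hmono,
    (Set.preimage_mono Set.ordConnectedComponent_subset).trans hOU⟩

theorem SuborderableSpace.subtype {Z : Type v} [TopologicalSpace Z]
    (hZ : SuborderableSpace.{v, w} Z) (s : Set Z) : SuborderableSpace.{v, w} s := by
  obtain ⟨L, tL, hL, e, he⟩ := hZ
  exact ⟨L, tL, hL, e ∘ Subtype.val, he.comp Topology.IsEmbedding.subtypeVal⟩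

theorem ClosurePreservingClosed.image {Z Y ι : Type*} [TopologicalSpace Z] [TopologicalSpace Y]
    {F : ι → Set Z} (hF : ClosurePreservingClosed F) {f : Z → Y} (hf : IsClosedMap f) :
    ClosurePreservingClosed fun i => f '' F i := fun J => by
  rw [← Set.image_iUnion₂]
  exact hf _ (hF J)

/-- Closed images of suborderable spaces that map injectively into a space whose square carries an
open tournament are paracompact. -/
theorem paracompactSpace_of_isOpenTournament {Y : Type u} [TopologicalSpace Y]
    {Z : Type v} [TopologicalSpace Z] (hZ : SuborderableSpace.{v, w} Z)
    {f : Z → Y} (hf : Continuous f) (hfc : IsClosedMap f) (hfs : Function.Surjective f)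
    {E : Type*} [TopologicalSpace E] {e : Y → E} (he : Continuous e) (hei : Function.Injective e)
    {R : E × E → E × E → Prop} (hR : IsOpenTournament R) : ParacompactSpace Y := by
  obtain ⟨_, hGO⟩ := hZ.exists_isGOSpace
  refine HasClosurePreservingRefinements.paracompactSpace fun ι U hU hcov => ?_
  obtain ⟨F, h1, h2, h3⟩ := hGO.covered_univ hf hU hcov he hei hR
  refine ⟨fun i => f '' F i, h1.image hfc, fun i => Set.image_subset_iff.2 (h2 i), ?_⟩
  rw [← Set.image_iUnion, Set.univ_subset_iff.1 h3, Set.image_univ, hfs.range_eq]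

/-! ### Clopen separation and pseudo-character -/

section PseudoCharacter

variable {X : Type u} [TopologicalSpace X] {R : X × X → X × X → Prop}

/-- Half of the separation of `q` by clopen sets indexed by a set approaching `p`. -/
theorem IsOpenTournament.eq_of_forall_mem_closure (hR : IsOpenTournament R) {p q y : X} {A : Set X}
    (hp : p ∈ closure A) (h1 : ∀ x ∈ A, R (x, q) (p, y)) (h2 : ∀ x ∈ A, R (x, y) (p, q)) :
    y = q := by
  have hcont : ∀ y : X, Continuous fun z : X => (z, y) := fun y => by fun_prop
  by_contra hne
  rcases hR.total (x := (p, y)) (y := (p, q)) fun e => hne (congrArg Prod.snd e) with h | h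
  · obtain ⟨x, hx, hxA⟩ := mem_closure_iff.1 hp {x | R (p, y) (x, q)}
      ((hR.isOpen_right (p, y)).preimage (hcont q)) h
    exact hR.asymm hx (h1 x hxA)
  · obtain ⟨x, hx, hxA⟩ := mem_closure_iff.1 hp {x | R (p, q) (x, y)}
      ((hR.isOpen_right (p, q)).preimage (hcont y)) h
    exact hR.asymm hx (h2 x hxA)

theorem IsOpenTournament.flip {E : Type*} [TopologicalSpace E] {R : E → E → Prop}
    (hR : IsOpenTournament R) : IsOpenTournament fun x y => R y x :=
  ⟨fun h => (hR.total h).symm, hR.asymm, hR.isOpen_left, hR.isOpen_right⟩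

/-- As `x ≠ p`, no `y` makes the two points equal, so the complement is the opposite open
half-interval. -/
theorem IsOpenTournament.isClopen_right (hR : IsOpenTournament R) {x p : X} (q : X) (h : x ≠ p) :
    IsClopen {y | R (x, q) (p, y)} := by
  have hcont : Continuous fun z : X => (p, z) := by fun_prop
  refine ⟨⟨?_⟩, (hR.isOpen_right (x, q)).preimage hcont⟩
  convert (hR.isOpen_left (x, q)).preimage hcont using 1
  ext y
  refine ⟨fun hy => (hR.total fun e => h (congrArg Prod.fst e)).resolve_left hy,
    fun hy hy' => hR.asymm hy' hy⟩

/-- One-sided version of the clopen separation. -/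
theorem IsOpenTournament.exists_clopen_family_of_side (hR : IsOpenTournament R) {p q : X}
    {A : Set X} (hpA : p ∉ A) (hp : p ∈ closure A) (hside : ∀ x ∈ A, R (x, q) (p, q)) :
    ∃ S : A × Bool → Set X, (∀ j, IsClopen (S j)) ∧ ⋂ j, S j = {q} := by
  have hne : ∀ x : A, x.1 ≠ p := fun x h => hpA (h ▸ x.2)
  refine ⟨fun j => bif j.2 then {y | R (j.1.1, q) (p, y)} else {y | R (j.1.1, y) (p, q)}, ?_, ?_⟩
  · rintro ⟨x, _ | _⟩
    · exact hR.flip.isClopen_right q (hne x).symm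
    · exact hR.isClopen_right q (hne x)
  · refine Set.Subset.antisymm (fun y hy => ?_) ?_
    · rw [Set.mem_iInter] at hy
      exact hR.eq_of_forall_mem_closure hp (fun x hx => hy (⟨x, hx⟩, true))
        fun x hx => hy (⟨x, hx⟩, false)
    · rintro _ rfl
      refine Set.mem_iInter.2 ?_
      rintro ⟨x, _ | _⟩
      · exact hside x x.2
      · exact hside x x.2

/-- If `A` approaches `p`, every point is the intersection of at most `#A + #A` clopen sets. -/
theorem IsOpenTournament.exists_clopen_family (hR : IsOpenTournament R) {p : X} {A : Set X}
    (hpA : p ∉ A) (hp : p ∈ closure A) (q : X) :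
    ∃ B ⊆ A, ∃ S : B × Bool → Set X, (∀ j, IsClopen (S j)) ∧ ⋂ j, S j = {q} := by
  -- One of the two parts still approaches `p`; reversing `R` exchanges them.
  have hA : A = {x ∈ A | R (x, q) (p, q)} ∪ {x ∈ A | R (p, q) (x, q)} := by
    ext x
    refine ⟨fun hx => ?_, fun hx => hx.elim And.left And.left⟩
    have hne : x ≠ p := fun h => hpA (h ▸ hx)
    exact (hR.total fun e => hne (congrArg Prod.fst e)).imp (And.intro hx) (And.intro hx)
  rw [hA, closure_union] at hp
  rcases hp with hp | hp
  · exact ⟨_, Set.sep_subset _ _, hR.exists_clopen_family_of_side (fun h => hpA h.1) hp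
      fun x hx => hx.2⟩
  · exact ⟨_, Set.sep_subset _ _, hR.flip.exists_clopen_family_of_side (fun h => hpA h.1) hp
      fun x hx => hx.2⟩

theorem mem_closure_compl_of_not_isOpen {p : X} (hp : ¬ IsOpen ({p} : Set X)) :
    p ∈ closure ({p}ᶜ : Set X) := by
  by_contra h
  apply hp
  have : ({p}ᶜ : Set X) = closure {p}ᶜ := by
    refine Set.Subset.antisymm subset_closure fun x hx hxp => ?_
    exact h ((Set.mem_singleton_iff.1 hxp) ▸ hx)
  rw [← isClosed_compl_iff, this]
  exact isClosed_closure

theorem exists_approaching_set (hX : ¬ DiscreteTopology X) :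
    ∃ (p : X) (A : Set X), p ∉ A ∧ p ∈ closure A ∧ #A ≤ approachingNumber X := by
  have hne : {κ | ∃ p : X, ¬ IsOpen ({p} : Set X) ∧ κ = approachingNumberAt X p}.Nonempty := by
    by_contra h
    refine hX (discreteTopology_iff_isOpen_singleton.2 fun p => ?_)
    by_contra hp
    exact h ⟨_, p, hp, rfl⟩
  obtain ⟨p, hp, hκ⟩ := csInf_mem hne
  have hne' : {κ | ∃ A : Set X, A ⊆ {p}ᶜ ∧ p ∈ closure A ∧ #A ≤ κ}.Nonempty :=
    ⟨_, {p}ᶜ, subset_rfl, mem_closure_compl_of_not_isOpen hp, le_rfl⟩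
  obtain ⟨A, hA, hpA, hcard⟩ := csInf_mem hne'
  exact ⟨p, A, fun h => hA h rfl, hpA, hcard.trans hκ.ge⟩

theorem IsOpenTournament.pseudoCharacter_le [T1Space X] (hR : IsOpenTournament R)
    (hX : ¬ DiscreteTopology X) : pseudoCharacter X ≤ approachingNumber X := by
  obtain ⟨p, A, hpA, hp, hcard⟩ := exists_approaching_set hX
  -- A finite set is closed and could not approach `p`; infinitude absorbs the factor 2 below.
  have hinf : ℵ₀ ≤ #A := by
    rw [Cardinal.aleph0_le_mk_iff, Set.infinite_coe_iff]
    intro hfin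
    exact hpA (hfin.isClosed.closure_eq ▸ hp)
  refine ciSup_le' fun q => ?_
  obtain ⟨B, hB, S, hS, hSq⟩ := hR.exists_clopen_family hpA hp q
  calc pseudoCharacterAt X q ≤ #(Set.range S) := csInf_le' ⟨Set.range S, by
        rintro _ ⟨j, rfl⟩
        exact (hS j).isOpen, by rw [Set.sInter_range, hSq], rfl⟩
    _ ≤ #(B × Bool) := Cardinal.mk_range_le
    _ = #B * 2 := by simp
    _ ≤ #A * #A := mul_le_mul' (Cardinal.mk_le_mk_of_subset hB)
        ((Cardinal.natCast_lt_aleph0 (n := 2)).le.trans hinf)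
    _ = #A := Cardinal.mul_eq_self hinf
    _ ≤ approachingNumber X := hcard

theorem IsOpenTournament.totallySeparatedSpace (hR : IsOpenTournament R)
    (hX : ¬ DiscreteTopology X) : TotallySeparatedSpace X := by
  obtain ⟨p, A, hpA, hp, -⟩ := exists_approaching_set hX
  rw [totallySeparatedSpace_iff_exists_isClopen]
  intro q y hqy
  obtain ⟨B, -, S, hS, hSq⟩ := hR.exists_clopen_family hpA hp q
  have hq : ∀ j, q ∈ S j := Set.mem_iInter.1 (hSq ▸ Set.mem_singleton q)
  have hy : y ∉ ⋂ j, S j := by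
    rw [hSq]
    exact hqy.symm
  obtain ⟨j, hj⟩ := not_forall.1 fun h => hy (Set.mem_iInter.2 h)
  exact ⟨S j, hS j, hq j, hj⟩

end PseudoCharacter

/-- Total disconnectedness is taken in the strong sense (quasi-components are points): any two
distinct points are separated by a clopen set, which is Mathlib's `TotallySeparatedSpace`; it
implies `TotallyDisconnectedSpace`. -/
theorem corollary7p4 {X : Type u} [TopologicalSpace X] [T2Space X]
    {Z : Type v} [TopologicalSpace Z] (hZ : SuborderableSpace.{v, w} Z)
    (f : Z → X) (hf : Continuous f) (hfc : IsClosedMap f) (hfs : Function.Surjective f)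
    (hX : ¬ DiscreteTopology X)
    (hsel : AdmitsSepContWeakSelection (X × X)) :
    HereditarilyParacompact X ∧ TotallySeparatedSpace X ∧
      pseudoCharacter X ≤ approachingNumber X := by
  obtain ⟨R, hR⟩ := hsel.exists_isOpenTournament
  refine ⟨fun A => ?_, hR.totallySeparatedSpace hX, hR.pseudoCharacter_le hX⟩
  -- The subspace `A` is a closed image of `f ⁻¹' A`, and its inclusion into `X` lets the tournament
  -- be used without restricting it.
  exact paracompactSpace_of_isOpenTournament (hZ.subtype (f ⁻¹' A)) hf.restrictPreimage
    (hfc.restrictPreimage A) (Set.restrictPreimage_surjective A hfs) continuous_subtype_val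
    Subtype.val_injective hR
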